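/- Let $G$ be a finite simple graph with vertex set $V$, let $k$ be a field of any characteristic, let $R=k[x_v,y_v : v\in V]$, and let $\mathcal J(G)=(x_iy_j-x_jy_i : \{i,j\}\in E(G))\subseteq R$ be the binomial edge ideal of $G$. A linear forest in $G$ is a spanning subgraph $F$ of $G$ (so $V(F)=V$) every connected component of which is a path, where a single vertex counts as a path; it is maximal if no linear forest in $G$ has more edges, and $\mathsf{LF}(G)$ denotes the number of edges of a maximal linear forest in $G$. A leaf of $F$ is a vertex of degree at most $1$ in $F$ (an end point of one of its paths, including isolated vertices). The ideal $\mathcal J(G)$ is of König type if $\operatorname{grade}_R(\mathcal J(G))=\mathsf{LF}(G)$, where $\operatorname{grade}_R(I)$ is the supremum of the lengths of $R$-regular sequences contained in $I$. For a maximal linear forest $F$ in $G$ and $S\subseteq V$, the pair $(F,S)$ is an $\mathsf{LF}$-cover of $G$ if (1) no vertex in $S$ is a leaf of $F$; (2) no two vertices in $S$ are adjacent in $F$; and (3) for every edge $\{i,j\}\in E(G)$, either at least one of $i,j$ belongs to $S$, or $i$ and $j$ belong to the same connected component of $F\setminus S$. The graph $G$ is $\mathsf{LF}$-coverable if it has an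 $\mathsf{LF}$-cover $(F,S)$ for some maximal linear forest $F$ in $G$ and some $S\subseteq V$. Theorem. $\mathcal J(G)$ is of König type if and only if $G$ is $\mathsf{LF}$-coverable. Furthermore, for any two maximal linear forests $F$ and $F'$ in $G$ and any $S\subseteq V$, $(F,S)$ is an $\mathsf{LF}$-cover of $G$ if and only if $(F',S)$ is an $\mathsf{LF}$-cover of $G$. -/

import Mathlib

/-- A graph is a linear forest if every connected component is a path (possibly a single vertex). -/
def IsLinearForest {V : Type*} (F : SimpleGraph V) : Prop :=
  ∀ c : F.ConnectedComponent, ∃ m : ℕ, Nonempty (c.toSimpleGraph ≃g SimpleGraph.pathGraph m)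

/-- `F` is a maximal linear forest in `G`: a linear forest contained in `G` such that no linear
forest in `G` has more edges. Linear forests in `G` are spanning subgraphs: a vertex of `G` that
lies on no edge of `F` is a one-vertex path of `F`. -/
structure IsMaximalLinearForest {V : Type*} (G F : SimpleGraph V) : Prop where
  le : F ≤ G
  isLinearForest : IsLinearForest F
  maximal : ∀ F' : SimpleGraph V, F' ≤ G → IsLinearForest F' →
    F'.edgeSet.encard ≤ F.edgeSet.encard

/-- `LF(G)`, the largest number of edges of a linear forest in `G`. -/
noncomputable def LF {V : Type*} (G : SimpleGraph V) : ℕ∞ :=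
  ⨆ (F : SimpleGraph V) (_ : F ≤ G) (_ : IsLinearForest F), F.edgeSet.encard

/-- A leaf of a linear forest is an end point of one of its paths, that is, a vertex of degree at
most one; the only vertex of a one-vertex path is a leaf. -/
def IsLeaf {V : Type*} (F : SimpleGraph V) (v : V) : Prop :=
  (F.neighborSet v).encard ≤ 1

/-- `(F, S)` is an `LF`-cover of `G`. -/
structure IsLFCover {V : Type*} (G F : SimpleGraph V) (S : Set V) : Prop where
  isMaximal : IsMaximalLinearForest G F
  not_leaf : ∀ v ∈ S, ¬ IsLeaf F v
  not_adj : ∀ v ∈ S, ∀ w ∈ S, ¬ F.Adj v w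
  covers : ∀ i j : V, G.Adj i j → (i ∈ S ∨ j ∈ S) ∨
    ∃ (hi : i ∈ Sᶜ) (hj : j ∈ Sᶜ), (F.induce Sᶜ).Reachable ⟨i, hi⟩ ⟨j, hj⟩

/-- `G` is `LF`-coverable. -/
def IsLFCoverable {V : Type*} (G : SimpleGraph V) : Prop :=
  ∃ (F : SimpleGraph V) (S : Set V), IsLFCover G F S

/-- The binomial `x_i y_j - x_j y_i` in the polynomial ring with variables `x_v = X (inl v)` and
`y_v = X (inr v)`, for `v` in `V`. -/
noncomputable def edgeBinomial (k : Type*) [Field k] {V : Type*} (i j : V) :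
    MvPolynomial (V ⊕ V) k :=
  MvPolynomial.X (Sum.inl i) * MvPolynomial.X (Sum.inr j) -
    MvPolynomial.X (Sum.inl j) * MvPolynomial.X (Sum.inr i)

/-- The binomial edge ideal of `G`. An edge is listed in both orders, which only adds the negatives
of generators. -/
noncomputable def binomialEdgeIdeal (k : Type*) [Field k] {V : Type*} (G : SimpleGraph V) :
    Ideal (MvPolynomial (V ⊕ V) k) :=
  Ideal.span {f | ∃ i j : V, G.Adj i j ∧ f = edgeBinomial k i j}

/-- The grade of an ideal `I` of `R`: the supremum of the lengths of the `R`-regular sequences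
consisting of elements of `I`. -/
noncomputable def idealGrade {R : Type*} [CommRing R] (I : Ideal R) : ℕ∞ :=
  ⨆ (rs : List R) (_ : RingTheory.Sequence.IsRegular R rs) (_ : ∀ r ∈ rs, r ∈ I),
    (rs.length : ℕ∞)

/-- The binomial edge ideal of `G` over `k` is of König type. -/
def IsKonigType (k : Type*) [Field k] {V : Type*} (G : SimpleGraph V) : Prop :=
  idealGrade (binomialEdgeIdeal k G) = LF G

/-!
Let `c(G \ S)` be the number of components of `G \ S`. The grade of the binomial edge ideal `J(G)`
is the minimum of `|V| + |S| - c(G \ S)` over all sets of vertices `S`. Indeed, every element of an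
ideal `I` is a zero divisor modulo a maximal regular sequence in `I`, so by prime avoidance `I`
lies in a prime of the same grade. A prime containing `J(G)` contains the ideal `P_S(G)`, where `S`
is the set of the vertices both of whose variables lie in the prime: proportionality of the columns
`(x_v, y_v)` propagates along the walks of `G \ S`. Conversely `J(G) ≤ P_S(G)`, and the grade of
`P_S(G)` is `|V| + |S| - c(G \ S)`: the variables of `S` and the binomials of a path through each
component of `G \ S` (which need not be a path of `G`) form a maximal regular sequence in it.

On the combinatorial side, deleting `S` from a linear forest `F` in `G` removes at most `2|S|`
edges, and leaves a forest with `|V| - |S| - c(F \ S)` edges, where `c(F \ S) ≥ c(G \ S)`. Hence `F`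
has at most `|V| + |S| - c(G \ S)` edges. Equality means that every vertex of `S` has degree `2` in
`F`, that no two vertices of `S` are adjacent in `F`, and that `F \ S` and `G \ S` have the same
components. For maximal `F` this says that `(F, S)` is an `LF`-cover, and by counting it depends
only on the number of edges of `F`.
-/

section Depth

open CategoryTheory Abelian RingTheory.Sequence Pointwise

universe u

variable {R : Type u} [CommRing R]

theorem smul_top_quotSMulTop_lt_top {M : Type*} [AddCommGroup M] [Module R M] {I : Ideal R} {r : R}
    (hr : r ∈ I) (hI : I • (⊤ : Submodule R M) < ⊤) :
    I • (⊤ : Submodule R (QuotSMulTop r M)) < ⊤ := by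
  have hrI : r • (⊤ : Submodule R M) ≤ I • ⊤ := by
    rw [← Submodule.ideal_span_singleton_smul]
    exact Submodule.smul_mono_left ((Ideal.span_singleton_le_iff_mem I).2 hr)
  refine lt_top_iff_ne_top.2 fun h => hI.ne ?_
  rw [← sup_eq_left.2 hrI, ← Submodule.ker_mkQ (r • (⊤ : Submodule R M)),
    ← Submodule.comap_smul_top_of_surjective _ _ (Submodule.mkQ_surjective _)]
  exact (congrArg (Submodule.comap _) h).trans (Submodule.comap_top _)

/-- By Rees' theorem this is a statement about the vanishing of `Ext (R ⧸ I) _`, where it is read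
off the long exact sequence of `0 → M → M → M / r M → 0`. -/
theorem exists_isRegular_quotSMulTop [IsNoetherianRing R] {M : Type u} [AddCommGroup M]
    [Module R M] [Module.Finite R M] {I : Ideal R} (hI : I • (⊤ : Submodule R M) < ⊤) {r : R}
    (hr : r ∈ I) (hreg : IsSMulRegular M r) {ys : List R} (hys : IsRegular M ys)
    (hysI : ∀ y ∈ ys, y ∈ I) :
    ∃ zs : List R, zs.length = ys.length - 1 ∧ (∀ z ∈ zs, z ∈ I) ∧
      IsRegular (QuotSMulTop r M) zs := by
  have hM := (ModuleCat.exists_isRegular_tfae I ys.length (ModuleCat.of R M) hI).out 1 3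
  have hExt := hM.2 ⟨ys, rfl, hysI, hys⟩
  refine ((ModuleCat.exists_isRegular_tfae I (ys.length - 1) (ModuleCat.of R (QuotSMulTop r M))
    (smul_top_quotSMulTop_lt_top hr hI)).out 1 3).1 fun i hi => ?_
  have hi₀ := AddCommGrpCat.isZero_of_iff_subsingleton.2 (hExt i (by omega))
  have hi₁ := AddCommGrpCat.isZero_of_iff_subsingleton.2 (hExt (i + 1) (by omega))
  have hMr : IsSMulRegular (ModuleCat.of R M) r := hreg
  exact AddCommGrpCat.subsingleton_of_isZero <|
    (Ext.covariant_sequence_exact₃' _ hMr.smulShortComplex_shortExact i (i + 1) rfl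
      ).isZero_of_both_zeros (hi₀.eq_zero_of_src _) (hi₁.eq_zero_of_tgt _)

theorem exists_isSMulRegular_of_length_lt [IsNoetherianRing R] {M : Type u} [AddCommGroup M]
    [Module R M] [Module.Finite R M] {I : Ideal R} (hI : I • (⊤ : Submodule R M) < ⊤)
    {xs ys : List R} (hxs : IsWeaklyRegular M xs) (hxsI : ∀ x ∈ xs, x ∈ I) (hys : IsRegular M ys)
    (hysI : ∀ y ∈ ys, y ∈ I) (hlt : xs.length < ys.length) :
    ∃ r ∈ I, IsSMulRegular (M ⧸ Ideal.ofList xs • (⊤ : Submodule R M)) r := by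
  induction xs generalizing M ys with
  | nil =>
    obtain ⟨y, ys, rfl⟩ := List.exists_cons_of_length_pos hlt
    have e : (M ⧸ Ideal.ofList ([] : List R) • (⊤ : Submodule R M)) ≃ₗ[R] M :=
      Submodule.quotEquivOfEqBot _ (by simp)
    exact ⟨y, hysI y (by simp), (e.isSMulRegular_congr y).2 ((isRegular_cons_iff M y ys).1 hys).1⟩
  | cons x xs ih =>
    have hx : x ∈ I := hxsI x (by simp)
    obtain ⟨hxreg, hxs⟩ := (isWeaklyRegular_cons_iff M x xs).1 hxs
    obtain ⟨zs, hlen, hzsI, hzs⟩ := exists_isRegular_quotSMulTop hI hx hxreg hys hysI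
    obtain ⟨r, hr, hreg⟩ := ih (smul_top_quotSMulTop_lt_top hx hI) hxs
      (fun a ha => hxsI a (List.mem_cons_of_mem _ ha)) hzs hzsI (by grind)
    exact ⟨r, hr,
      ((Submodule.quotOfListConsSMulTopEquivQuotSMulTopInner M x xs).isSMulRegular_congr r).2 hreg⟩

theorem idealGrade_mono {I J : Ideal R} (h : I ≤ J) : idealGrade I ≤ idealGrade J :=
  iSup₂_mono fun _ _ => iSup_mono' fun hrs => ⟨fun r hr => h (hrs r hr), le_rfl⟩

theorem ofList_le_iff {I : Ideal R} {rs : List R} : Ideal.ofList rs ≤ I ↔ ∀ r ∈ rs, r ∈ I :=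
  Ideal.span_le

theorem isRegular_of_isWeaklyRegular {I : Ideal R} (hI : I ≠ ⊤) {rs : List R}
    (hrs : IsWeaklyRegular R rs) (hrsI : ∀ r ∈ rs, r ∈ I) : IsRegular R rs := by
  refine ⟨hrs, fun h => hI (top_le_iff.1 ?_)⟩
  rw [h, smul_eq_mul, Ideal.mul_top]
  exact ofList_le_iff.2 hrsI

theorem idealGrade_eq_length [IsNoetherianRing R] {I : Ideal R} (hI : I ≠ ⊤) {rs : List R}
    (hrs : IsWeaklyRegular R rs) (hrsI : ∀ r ∈ rs, r ∈ I)
    (hmax : ∀ p ∈ I, ¬ IsSMulRegular (R ⧸ Ideal.ofList rs) p) : idealGrade I = rs.length := by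
  apply le_antisymm
  · refine iSup₂_le fun ys hys => iSup_le fun hysI => ?_
    by_contra! hlt
    obtain ⟨r, hr, hreg⟩ := exists_isSMulRegular_of_length_lt (M := R)
      (by simpa using hI.lt_top) hrs hrsI hys hysI (by exact_mod_cast hlt)
    exact hmax r hr (((Submodule.quotEquivOfEq _ _ (by simp)).isSMulRegular_congr r).1 hreg)
  · exact le_iSup₂_of_le rs (isRegular_of_isWeaklyRegular hI hrs hrsI) (le_iSup_of_le hrsI le_rfl)

theorem isWeaklyRegular_concat_iff {rs : List R} {p : R} :
    IsWeaklyRegular R (rs ++ [p]) ↔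
      IsWeaklyRegular R rs ∧ IsSMulRegular (R ⧸ Ideal.ofList rs) p := by
  rw [isWeaklyRegular_append_iff, isWeaklyRegular_singleton_iff]
  exact and_congr_right' ((Submodule.quotEquivOfEq _ _ (by simp)).isSMulRegular_congr p)

theorem exists_maximal_isWeaklyRegular [IsNoetherianRing R] {I : Ideal R} (hI : I ≠ ⊤) :
    ∃ rs : List R, IsWeaklyRegular R rs ∧ (∀ r ∈ rs, r ∈ I) ∧
      ∀ p ∈ I, ¬ IsSMulRegular (R ⧸ Ideal.ofList rs) p := by
  obtain ⟨_, ⟨rs, hrs, hrsI, rfl⟩, hmax⟩ := set_has_maximal_iff_noetherian.2 ‹_›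
    {J : Ideal R | ∃ rs : List R, IsWeaklyRegular R rs ∧ (∀ r ∈ rs, r ∈ I) ∧ Ideal.ofList rs = J}
    ⟨_, [], .nil R R, by simp, rfl⟩
  refine ⟨rs, hrs, hrsI, fun p hp hreg => ?_⟩
  have hle : Ideal.ofList rs ≤ I := ofList_le_iff.2 hrsI
  refine hmax (Ideal.ofList (rs ++ [p]))
    ⟨rs ++ [p], isWeaklyRegular_concat_iff.2 ⟨hrs, hreg⟩, by grind, rfl⟩ ?_
  rw [Ideal.ofList_append, Ideal.ofList_singleton, left_lt_sup, Ideal.span_singleton_le_iff_mem]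
  intro hprs
  have : Nontrivial (R ⧸ Ideal.ofList rs) :=
    Ideal.Quotient.nontrivial_iff.2 (ne_top_of_le_ne_top hI hle)
  refine one_ne_zero (α := R ⧸ Ideal.ofList rs) (hreg ?_)
  simp [Algebra.smul_def, Ideal.Quotient.eq_zero_iff_mem.2 hprs]

theorem exists_associatedPrime_ge_of_forall_not_isSMulRegular [IsNoetherianRing R] {M : Type*}
    [AddCommGroup M] [Module R M] [Module.Finite R M] {I : Ideal R}
    (h : ∀ p ∈ I, ¬ IsSMulRegular M p) : ∃ Q ∈ associatedPrimes R M, I ≤ Q := by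
  refine (Ideal.subset_union_prime_finite (associatedPrimes.finite R M) ⊥ ⊥
    fun Q hQ _ _ => hQ.isPrime).1 fun p hp => ?_
  rw [biUnion_associatedPrimes_eq_compl_regular]
  exact h p hp

theorem exists_isPrime_idealGrade_eq [IsNoetherianRing R] {I : Ideal R} (hI : I ≠ ⊤) :
    ∃ Q : Ideal R, Q.IsPrime ∧ I ≤ Q ∧ idealGrade Q = idealGrade I := by
  obtain ⟨rs, hrs, hrsI, hmax⟩ := exists_maximal_isWeaklyRegular hI
  obtain ⟨Q, hQ, hIQ⟩ := exists_associatedPrime_ge_of_forall_not_isSMulRegular hmax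
  refine ⟨Q, hQ.isPrime, hIQ, ?_⟩
  rw [idealGrade_eq_length hI hrs hrsI hmax]
  refine idealGrade_eq_length hQ.isPrime.ne_top hrs (fun r hr => hIQ (hrsI r hr)) fun p hp => ?_
  have : p ∈ {r : R | IsSMulRegular (R ⧸ Ideal.ofList rs) r}ᶜ := by
    rw [← biUnion_associatedPrimes_eq_compl_regular]
    exact Set.mem_biUnion hQ hp
  exact this

end Depth

section QuotientRegular

open RingTheory.Sequence

variable {R : Type*} [CommRing R] {I : Ideal R}

theorem isWeaklyRegular_quotient_append_iff {rs ss : List R} :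
    IsWeaklyRegular (R ⧸ I) (rs ++ ss) ↔
      IsWeaklyRegular (R ⧸ I) rs ∧ IsWeaklyRegular (R ⧸ (I ⊔ Ideal.ofList rs)) ss := by
  have h : Ideal.ofList rs • (⊤ : Submodule R (R ⧸ I)) =
      Submodule.map I.mkQ (Ideal.ofList rs) := by
    rw [← Submodule.range_mkQ I, ← Submodule.map_top, ← Submodule.map_smul'', smul_eq_mul,
      Ideal.mul_top]
  rw [isWeaklyRegular_append_iff, h]
  exact and_congr_right'
    ((Submodule.quotientQuotientEquivQuotientSup I (Ideal.ofList rs)).isWeaklyRegular_congr ss)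

theorem isWeaklyRegular_quotient_cons_iff {r : R} {rs : List R} :
    IsWeaklyRegular (R ⧸ I) (r :: rs) ↔
      IsSMulRegular (R ⧸ I) r ∧ IsWeaklyRegular (R ⧸ (I ⊔ Ideal.span {r})) rs := by
  rw [← List.singleton_append, isWeaklyRegular_quotient_append_iff, isWeaklyRegular_singleton_iff,
    Ideal.ofList_singleton]

theorem isSMulRegular_quotient_sup_swap {x z : R} (hx : IsSMulRegular (R ⧸ I) x)
    (hz : IsSMulRegular (R ⧸ (I ⊔ Ideal.span {x})) z) :
    IsSMulRegular (R ⧸ (I ⊔ Ideal.span {z})) x := by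
  simp only [isSMulRegular_quotient_iff_mem_of_smul_mem, smul_eq_mul,
    Submodule.mem_sup, Ideal.mem_span_singleton', exists_exists_eq_and] at hx hz ⊢
  rintro g ⟨i, hi, h, hg⟩
  obtain ⟨i', hi', h', rfl⟩ := hz h ⟨-i, I.neg_mem hi, g, by linear_combination -hg⟩
  refine ⟨g - h' * z, hx _ ?_, h', by ring⟩
  rw [show x * (g - h' * z) = i + z * i' by linear_combination -hg]
  exact I.add_mem hi (I.mul_mem_left _ hi')

theorem not_isSMulRegular_quotient_of_forall_isPrime {P : Ideal R} [P.IsPrime] (hIP : I ≤ P) {p : R}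
    (hp : ∀ Q : Ideal R, Q.IsPrime → I ≤ Q → Q ≤ P → p ∈ Q) : ¬ IsSMulRegular (R ⧸ I) p := by
  obtain ⟨Q, hQ, hQP⟩ := Ideal.exists_minimalPrimes_le hIP
  intro hreg
  exact hreg.notMem_of_mem_minimalPrimes (by rwa [Ideal.annihilator_quotient])
    (hp Q hQ.1.1 hQ.1.2 hQP)

theorem isSMulRegular_quotient_map_C {p : Polynomial R} (n : ℕ)
    (hp : IsSMulRegular (R ⧸ I) (p.coeff n)) :
    IsSMulRegular (Polynomial R ⧸ I.map Polynomial.C) p := by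
  have hmem (f : Polynomial R) :
      f ∈ I.map Polynomial.C ↔ f.map (Ideal.Quotient.mk I) = 0 := by
    rw [← Polynomial.coe_mapRingHom, ← RingHom.mem_ker, Polynomial.ker_mapRingHom, Ideal.mk_ker]
  have hcoeff : (p.map (Ideal.Quotient.mk I)).coeff n ∈ nonZeroDivisors (R ⧸ I) := by
    rw [Polynomial.coeff_map, mem_nonZeroDivisors_iff_left]
    exact fun x hx => hp.right_eq_zero_of_smul (by rwa [Algebra.smul_def])
  rw [isSMulRegular_quotient_iff_mem_of_smul_mem]
  intro f hf
  rw [smul_eq_mul, hmem, Polynomial.map_mul] at hf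
  exact (hmem f).2 ((mem_nonZeroDivisors_iff_left.1
    (Polynomial.mem_nonzeroDivisors_of_coeff_mem n hcoeff)) _ hf)

end QuotientRegular

section FreeOf

open MvPolynomial RingTheory.Sequence

variable {A σ : Type*} [CommRing A] {T T' : Set σ} {t : σ} {I J : Ideal (MvPolynomial σ A)}

/-- The ideal `I` is generated by polynomials in which no variable from `T` occurs, that is, `I` is
extended from the polynomial ring in the remaining variables. -/
def FreeOf (T : Set σ) (I : Ideal (MvPolynomial σ A)) : Prop :=
  ∃ s : Set (MvPolynomial σ A), I = Ideal.span s ∧ ∀ g ∈ s, g ∈ supported A Tᶜ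

theorem freeOf_bot : FreeOf T (⊥ : Ideal (MvPolynomial σ A)) :=
  ⟨∅, by simp, by simp⟩

theorem freeOf_ofList {fs : List (MvPolynomial σ A)} (hf : ∀ f ∈ fs, f ∈ supported A Tᶜ) :
    FreeOf T (Ideal.ofList fs) :=
  ⟨{f | f ∈ fs}, rfl, hf⟩

theorem freeOf_span_singleton {f : MvPolynomial σ A} (hf : f ∈ supported A Tᶜ) :
    FreeOf T (Ideal.span {f}) :=
  ⟨{f}, rfl, by simpa using hf⟩

theorem FreeOf.mono (h : FreeOf T I) (hT : T' ⊆ T) : FreeOf T' I := by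
  obtain ⟨s, rfl, hs⟩ := h
  exact ⟨s, rfl, fun g hg => supported_mono (Set.compl_subset_compl.2 hT) (hs g hg)⟩

theorem FreeOf.sup (hI : FreeOf T I) (hJ : FreeOf T J) : FreeOf T (I ⊔ J) := by
  obtain ⟨s, rfl, hs⟩ := hI
  obtain ⟨t, rfl, ht⟩ := hJ
  exact ⟨s ∪ t, (Ideal.span_union s t).symm, fun g hg => hg.elim (hs g) (ht g)⟩

/-- The polynomial ring as a univariate polynomial ring in the variable `t` over the polynomial ring
in the other variables. -/
noncomputable def polynomialIn (A : Type*) [CommRing A] {σ : Type*} [DecidableEq σ] (t : σ) :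
    MvPolynomial σ A ≃ₐ[A] Polynomial (MvPolynomial {b // b ≠ t} A) :=
  (renameEquiv A (Equiv.optionSubtypeNe t).symm).trans (optionEquivLeft A _)

theorem polynomialIn_X_self [DecidableEq σ] : polynomialIn A t (X t) = Polynomial.X := by
  simp [polynomialIn]

theorem polynomialIn_rename [DecidableEq σ] (p : MvPolynomial {b // b ≠ t} A) :
    polynomialIn A t (rename Subtype.val p) = Polynomial.C p := by
  suffices h : ((polynomialIn A t).toAlgHom.comp (rename Subtype.val)) =
      (Algebra.ofId (MvPolynomial {b // b ≠ t} A)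
        (Polynomial (MvPolynomial {b // b ≠ t} A))).restrictScalars A from
    DFunLike.congr_fun h p
  ext i : 1
  simp [polynomialIn, Equiv.optionSubtypeNe_symm_of_ne i.2, Algebra.ofId_apply]

theorem exists_rename_of_mem_supported_compl {p : MvPolynomial σ A} (hp : p ∈ supported A {t}ᶜ) :
    ∃ p' : MvPolynomial {b // b ≠ t} A, rename Subtype.val p' = p :=
  exists_rename_eq_of_vars_subset_range p _ Subtype.val_injective
    (by simpa [Set.compl_def] using mem_supported.1 hp)

theorem FreeOf.exists_mem_iff_polynomialIn_mem [DecidableEq σ] (hI : FreeOf {t} I) :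
    ∃ I' : Ideal (MvPolynomial {b // b ≠ t} A),
      ∀ f, f ∈ I ↔ polynomialIn A t f ∈ I'.map Polynomial.C := by
  obtain ⟨s, rfl, hs⟩ := hI
  refine ⟨Ideal.span (rename Subtype.val ⁻¹' s), fun f => ?_⟩
  have himage :
      rename Subtype.val '' (rename (R := A) (Subtype.val : {b // b ≠ t} → σ) ⁻¹' s) = s :=
    Set.image_preimage_eq_of_subset fun g hg => exists_rename_of_mem_supported_compl (hs g hg)
  have hmap : (Ideal.span s).map (polynomialIn A t) =
      (Ideal.span (rename Subtype.val ⁻¹' s)).map Polynomial.C := by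
    conv_lhs => rw [← himage]
    simp only [Ideal.map_span, Set.image_image, polynomialIn_rename]
  rw [← hmap, ← Ideal.mem_comap, Ideal.comap_map_of_bijective _ (polynomialIn A t).bijective]

theorem FreeOf.isSMulRegular_mul_X_add (hI : FreeOf {t} I) {a c : MvPolynomial σ A}
    (ha : a ∈ supported A {t}ᶜ) (hc : c ∈ supported A {t}ᶜ)
    (hreg : IsSMulRegular (MvPolynomial σ A ⧸ I) a) :
    IsSMulRegular (MvPolynomial σ A ⧸ I) (a * X t + c) := by
  classical
  obtain ⟨I', hI'⟩ := hI.exists_mem_iff_polynomialIn_mem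
  obtain ⟨a, rfl⟩ := exists_rename_of_mem_supported_compl ha
  obtain ⟨c, rfl⟩ := exists_rename_of_mem_supported_compl hc
  simp only [isSMulRegular_quotient_iff_mem_of_smul_mem, smul_eq_mul, hI', map_mul, map_add,
    polynomialIn_X_self, polynomialIn_rename] at hreg ⊢
  have hcoeff : IsSMulRegular (MvPolynomial {b // b ≠ t} A ⧸ I')
      ((Polynomial.C a * Polynomial.X + Polynomial.C c).coeff 1) := by
    rw [isSMulRegular_quotient_iff_mem_of_smul_mem]
    intro g hg
    have := hreg (rename Subtype.val g)
    rw [polynomialIn_rename, ← Polynomial.C_mul] at this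
    simpa using Ideal.mem_map_C_iff.1 (this (Ideal.mem_map_of_mem _ (by simpa using hg))) 0
  exact fun g hg => (isSMulRegular_quotient_iff_mem_of_smul_mem _ _).1
    (isSMulRegular_quotient_map_C 1 hcoeff) _ hg

theorem FreeOf.isSMulRegular_X (hI : FreeOf {t} I) :
    IsSMulRegular (MvPolynomial σ A ⧸ I) (X t : MvPolynomial σ A) := by
  simpa using hI.isSMulRegular_mul_X_add (one_mem _) (zero_mem _) (IsSMulRegular.one _)

theorem FreeOf.isWeaklyRegular_map_X {ts : List σ} (hI : FreeOf {t | t ∈ ts} I) (hts : ts.Nodup) :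
    IsWeaklyRegular (MvPolynomial σ A ⧸ I) (ts.map X : List (MvPolynomial σ A)) := by
  induction ts generalizing I with
  | nil => exact .nil _ _
  | cons t ts ih =>
    rw [List.nodup_cons] at hts
    refine isWeaklyRegular_quotient_cons_iff.2 ⟨(hI.mono (by simp)).isSMulRegular_X, ih ?_ hts.2⟩
    exact (hI.mono fun _ h => List.mem_cons_of_mem _ h).sup
      (freeOf_span_singleton (Algebra.subset_adjoin ⟨t, hts.1, rfl⟩))

end FreeOf

section PathBinomials

open MvPolynomial RingTheory.Sequence

variable {k V : Type*} [Field k]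

theorem edgeBinomial_self (i : V) : edgeBinomial k i i = 0 := sub_self _

theorem edgeBinomial_swap (i j : V) : edgeBinomial k i j = -edgeBinomial k j i :=
  (neg_sub _ _).symm

/-- Modulo a prime that does not contain both variables of `b`, having a column proportional to
that of `b` is a transitive relation. -/
theorem edgeBinomial_mem_trans {Q : Ideal (MvPolynomial (V ⊕ V) k)} [Q.IsPrime] {a b c : V}
    (hb : X (Sum.inl b) ∉ Q ∨ X (Sum.inr b) ∉ Q) (hab : edgeBinomial k a b ∈ Q)
    (hbc : edgeBinomial k b c ∈ Q) : edgeBinomial k a c ∈ Q := by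
  have hcramer (z : V → MvPolynomial (V ⊕ V) k)
      (e : z b * edgeBinomial k a c = z a * edgeBinomial k b c + z c * edgeBinomial k a b) :
      z b * edgeBinomial k a c ∈ Q :=
    e ▸ Q.add_mem (Q.mul_mem_left _ hbc) (Q.mul_mem_left _ hab)
  rcases hb with hb | hb
  · exact (Ideal.IsPrime.mem_or_mem ‹_› (hcramer (fun v => X (Sum.inl v))
      (by simp only [edgeBinomial]; ring))).resolve_left hb
  · exact (Ideal.IsPrime.mem_or_mem ‹_› (hcramer (fun v => X (Sum.inr v))
      (by simp only [edgeBinomial]; ring))).resolve_left hb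

/-- The set of the variables `x_v` and `y_v` with `v` in `T`. -/
def vertexVars {V : Type*} (T : Set V) : Set (V ⊕ V) := {t | Sum.elim id id t ∈ T}

theorem vertexVars_mono {T T' : Set V} (h : T ⊆ T') : vertexVars T ⊆ vertexVars T' :=
  fun _ ht => h ht

theorem edgeBinomial_mem_supported {T : Set V} {i j : V} (hi : i ∉ T) (hj : j ∉ T) :
    edgeBinomial k i j ∈ supported k (vertexVars T)ᶜ := by
  unfold edgeBinomial
  refine sub_mem (mul_mem ?_ ?_) (mul_mem ?_ ?_) <;> simpa [vertexVars]

/-- The binomials of the consecutive pairs of a list of vertices, that is, the generators of the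
binomial edge ideal of a path. -/
noncomputable def pathBinomials (k : Type*) [Field k] {V : Type*} :
    List V → List (MvPolynomial (V ⊕ V) k)
  | [] => []
  | [_] => []
  | u :: w :: ws => edgeBinomial k u w :: pathBinomials k (w :: ws)

theorem exists_of_mem_pathBinomials {l : List V} {f : MvPolynomial (V ⊕ V) k}
    (hf : f ∈ pathBinomials k l) : ∃ i ∈ l, ∃ j ∈ l, f = edgeBinomial k i j := by
  induction l using pathBinomials.induct with
  | case1 | case2 => simp [pathBinomials] at hf
  | case3 u w ws ih =>
    rcases List.mem_cons.1 hf with rfl | hf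
    · exact ⟨u, by simp, w, by simp, rfl⟩
    · obtain ⟨i, hi, j, hj, rfl⟩ := ih hf
      exact ⟨i, List.mem_cons_of_mem _ hi, j, List.mem_cons_of_mem _ hj, rfl⟩

theorem length_pathBinomials (l : List V) : (pathBinomials k l).length = l.length - 1 := by
  induction l using pathBinomials.induct with
  | case1 | case2 => rfl
  | case3 u w ws ih => simp [pathBinomials, ih]

theorem edgeBinomial_mem_of_pathBinomials {Q : Ideal (MvPolynomial (V ⊕ V) k)} [Q.IsPrime]
    {l : List V} (hl : ∀ w ∈ l, X (Sum.inl w) ∉ Q) (hQ : ∀ f ∈ pathBinomials k l, f ∈ Q) {i j : V}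
    (hi : i ∈ l) (hj : j ∈ l) : edgeBinomial k i j ∈ Q := by
  induction l using pathBinomials.induct generalizing i j with
  | case1 => simp at hi
  | case2 => simp_all [edgeBinomial_self]
  | case3 u w ws ih =>
    have htail : ∀ i ∈ w :: ws, ∀ j ∈ w :: ws, edgeBinomial k i j ∈ Q := fun i hi j hj =>
      ih (fun v hv => hl v (List.mem_cons_of_mem _ hv))
        (fun f hf => hQ f (List.mem_cons_of_mem _ hf)) hi hj
    have hhead : ∀ j ∈ w :: ws, edgeBinomial k u j ∈ Q := fun j hj =>
      edgeBinomial_mem_trans (Or.inl (hl w (by simp))) (hQ _ List.mem_cons_self)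
        (htail w List.mem_cons_self j hj)
    rcases List.mem_cons.1 hi with hi | hi <;> rcases List.mem_cons.1 hj with hj | hj
    · simp [hi, hj, edgeBinomial_self]
    · exact hi ▸ hhead j hj
    · rw [hj, edgeBinomial_swap]
      exact Q.neg_mem (hhead i hi)
    · exact htail i hi j hj

theorem FreeOf.isSMulRegular_edgeBinomial {I : Ideal (MvPolynomial (V ⊕ V) k)} {u w : V}
    (huw : u ≠ w) (hI : FreeOf (vertexVars {w}) I)
    (hu : IsSMulRegular (MvPolynomial (V ⊕ V) k ⧸ I) (X (Sum.inl u) : MvPolynomial (V ⊕ V) k)) :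
    IsSMulRegular (MvPolynomial (V ⊕ V) k ⧸ I) (edgeBinomial k u w) ∧
      IsSMulRegular (MvPolynomial (V ⊕ V) k ⧸ (I ⊔ Ideal.span {edgeBinomial k u w}))
        (X (Sum.inl w) : MvPolynomial (V ⊕ V) k) := by
  have hx : FreeOf {Sum.inl w} I := hI.mono (by simp [vertexVars])
  have hy : FreeOf {Sum.inr w} I := hI.mono (by simp [vertexVars])
  have hedge : edgeBinomial k u w =
      X (Sum.inl u) * X (Sum.inr w) + -(X (Sum.inl w) * X (Sum.inr u)) := sub_eq_add_neg _ _
  have hcoeff : (X (Sum.inl u) : MvPolynomial (V ⊕ V) k) ∈ supported k {Sum.inr w}ᶜ := by simp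
  have hconst : -(X (Sum.inl w) * X (Sum.inr u) : MvPolynomial (V ⊕ V) k) ∈
      supported k {Sum.inr w}ᶜ := neg_mem (mul_mem (by simp) (by simpa using huw))
  have hu' : IsSMulRegular (MvPolynomial (V ⊕ V) k ⧸ (I ⊔ Ideal.span {X (Sum.inl w)}))
      (X (Sum.inl u) : MvPolynomial (V ⊕ V) k) :=
    isSMulRegular_quotient_sup_swap hu
      (hx.sup (freeOf_span_singleton (by simpa using huw))).isSMulRegular_X
  rw [hedge]
  exact ⟨hy.isSMulRegular_mul_X_add hcoeff hconst hu,
    isSMulRegular_quotient_sup_swap hx.isSMulRegular_X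
      ((hy.sup (freeOf_span_singleton (by simp))).isSMulRegular_mul_X_add hcoeff hconst hu')⟩

theorem FreeOf.isWeaklyRegular_pathBinomials_cons {I : Ideal (MvPolynomial (V ⊕ V) k)} {u : V}
    {ws : List V} (hI : FreeOf (vertexVars {w | w ∈ ws}) I) (hws : (u :: ws).Nodup)
    (hu : IsSMulRegular (MvPolynomial (V ⊕ V) k ⧸ I) (X (Sum.inl u) : MvPolynomial (V ⊕ V) k)) :
    IsWeaklyRegular (MvPolynomial (V ⊕ V) k ⧸ I) (pathBinomials k (u :: ws)) := by
  induction ws generalizing u I with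
  | nil => exact .nil _ _
  | cons w ws ih =>
    obtain ⟨hedge, hw⟩ := FreeOf.isSMulRegular_edgeBinomial (w := w) (by grind)
      (hI.mono (vertexVars_mono (by simp))) hu
    refine isWeaklyRegular_quotient_cons_iff.2 ⟨hedge, ih ?_ hws.of_cons hw⟩
    exact (hI.mono (vertexVars_mono fun _ h => List.mem_cons_of_mem _ h)).sup
      (freeOf_span_singleton (edgeBinomial_mem_supported (T := {w | w ∈ ws}) (by grind) (by grind)))

theorem FreeOf.isWeaklyRegular_pathBinomials {I : Ideal (MvPolynomial (V ⊕ V) k)} {l : List V}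
    (hI : FreeOf (vertexVars {w | w ∈ l}) I) (hl : l.Nodup) :
    IsWeaklyRegular (MvPolynomial (V ⊕ V) k ⧸ I) (pathBinomials k l) := by
  cases l with
  | nil => exact .nil _ _
  | cons u ws =>
    exact (hI.mono (vertexVars_mono fun _ h => List.mem_cons_of_mem _ h)
      ).isWeaklyRegular_pathBinomials_cons hl (hI.mono (by simp [vertexVars])).isSMulRegular_X

theorem FreeOf.isWeaklyRegular_flatMap_pathBinomials {I : Ideal (MvPolynomial (V ⊕ V) k)}
    {L : List (List V)} (hI : FreeOf (vertexVars {w | w ∈ L.flatten}) I) (hL : L.flatten.Nodup) :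
    IsWeaklyRegular (MvPolynomial (V ⊕ V) k ⧸ I) (L.flatMap (pathBinomials k)) := by
  induction L generalizing I with
  | nil => exact .nil _ _
  | cons l L ih =>
    rw [List.flatten_cons, List.nodup_append'] at hL
    obtain ⟨hl, hL, hdisj⟩ := hL
    rw [List.flatMap_cons, isWeaklyRegular_quotient_append_iff]
    refine ⟨(hI.mono (vertexVars_mono fun _ h => by simp_all)).isWeaklyRegular_pathBinomials hl,
      ih ((hI.mono (vertexVars_mono fun _ h => by simp_all)).sup (freeOf_ofList fun f hf => ?_)) hL⟩
    obtain ⟨i, hi, j, hj, rfl⟩ := exists_of_mem_pathBinomials hf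
    exact edgeBinomial_mem_supported (hdisj hi) (hdisj hj)

end PathBinomials

section CutIdeal

open MvPolynomial RingTheory.Sequence

variable {k V : Type*} [Field k] {G : SimpleGraph V} {S : Set V}

/-- The ideal `P_S(G)`, generated by the variables of the vertices in `S` and by the binomials of
all pairs of vertices lying in one component of `G \ S`. -/
noncomputable def cutIdeal (k : Type*) [Field k] {V : Type*} (G : SimpleGraph V) (S : Set V) :
    Ideal (MvPolynomial (V ⊕ V) k) :=
  Ideal.span (X '' vertexVars S ∪
    {f | ∃ i j : ↥Sᶜ, (G.induce Sᶜ).Reachable i j ∧ f = edgeBinomial k (i : V) j})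

theorem X_mem_cutIdeal {t : V ⊕ V} (ht : t ∈ vertexVars S) : X t ∈ cutIdeal k G S :=
  Ideal.subset_span (Or.inl ⟨t, ht, rfl⟩)

theorem edgeBinomial_mem_cutIdeal {i j : ↥Sᶜ} (h : (G.induce Sᶜ).Reachable i j) :
    edgeBinomial k (i : V) j ∈ cutIdeal k G S :=
  Ideal.subset_span (Or.inr ⟨i, j, h, rfl⟩)

theorem cutIdeal_le_iff {Q : Ideal (MvPolynomial (V ⊕ V) k)} :
    cutIdeal k G S ≤ Q ↔ (∀ t ∈ vertexVars S, X t ∈ Q) ∧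
      ∀ i j : ↥Sᶜ, (G.induce Sᶜ).Reachable i j → edgeBinomial k (i : V) j ∈ Q := by
  refine ⟨fun h => ⟨fun t ht => h (X_mem_cutIdeal ht),
    fun i j hij => h (edgeBinomial_mem_cutIdeal hij)⟩, fun ⟨hX, hedge⟩ => Ideal.span_le.2 ?_⟩
  rintro f (⟨t, ht, rfl⟩ | ⟨i, j, hij, rfl⟩)
  exacts [hX t ht, hedge i j hij]

theorem binomialEdgeIdeal_le_cutIdeal : binomialEdgeIdeal k G ≤ cutIdeal k G S := by
  refine Ideal.span_le.2 ?_
  rintro f ⟨i, j, hij, rfl⟩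
  by_cases hi : i ∈ S
  · exact Ideal.sub_mem _ (Ideal.mul_mem_right _ _ (X_mem_cutIdeal hi))
      (Ideal.mul_mem_left _ _ (X_mem_cutIdeal hi))
  by_cases hj : j ∈ S
  · exact Ideal.sub_mem _ (Ideal.mul_mem_left _ _ (X_mem_cutIdeal hj))
      (Ideal.mul_mem_right _ _ (X_mem_cutIdeal hj))
  exact edgeBinomial_mem_cutIdeal (i := ⟨i, hi⟩) (j := ⟨j, hj⟩) (SimpleGraph.Adj.reachable hij)

theorem exists_cutIdeal_le_of_isPrime {Q : Ideal (MvPolynomial (V ⊕ V) k)} [Q.IsPrime]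
    (hG : binomialEdgeIdeal k G ≤ Q) : ∃ S : Set V, cutIdeal k G S ≤ Q := by
  let S : Set V := {v | X (Sum.inl v) ∈ Q ∧ X (Sum.inr v) ∈ Q}
  refine ⟨S, cutIdeal_le_iff.2 ⟨?_, fun i j hij => ?_⟩⟩
  · rintro (v | v) hv
    exacts [hv.1, hv.2]
  rw [SimpleGraph.reachable_iff_reflTransGen] at hij
  induction hij with
  | refl => simp [edgeBinomial_self]
  | @tail b c _ hbc ih =>
    exact edgeBinomial_mem_trans (not_and_or.1 b.2) ih (hG (Ideal.subset_span ⟨b, c, hbc, rfl⟩))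

/-- The variables of the vertices in `s`, followed by the path binomials of the lists in `L`. When
`s` lists `S` and `L` lists the components of `G \ S`, this is a maximal regular sequence in the
ideal `P_S(G)`. -/
noncomputable def cutSequence (k : Type*) [Field k] {V : Type*} (s : List V) (L : List (List V)) :
    List (MvPolynomial (V ⊕ V) k) :=
  (s.map Sum.inl ++ s.map Sum.inr).map X ++ L.flatMap (pathBinomials k)

variable {s : List V} {L : List (List V)}

theorem mem_cutSequence {f : MvPolynomial (V ⊕ V) k} :
    f ∈ cutSequence k s L ↔
      (∃ t ∈ vertexVars {v | v ∈ s}, X t = f) ∨ ∃ l ∈ L, f ∈ pathBinomials k l := by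
  simp [cutSequence, vertexVars, or_assoc]

theorem isWeaklyRegular_cutSequence (hs : s.Nodup) (hL : L.flatten.Nodup)
    (hsL : s.Disjoint L.flatten) :
    IsWeaklyRegular (MvPolynomial (V ⊕ V) k) (cutSequence k s L) := by
  have hts : (s.map (Sum.inl : V → V ⊕ V) ++ s.map Sum.inr).Nodup :=
    List.nodup_append'.2
      ⟨hs.map Sum.inl_injective, hs.map Sum.inr_injective, by simp [List.Disjoint]⟩
  rw [← ((Submodule.quotEquivOfEqBot _ rfl).isWeaklyRegular_congr), cutSequence,
    isWeaklyRegular_quotient_append_iff]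
  refine ⟨freeOf_bot.isWeaklyRegular_map_X hts, FreeOf.isWeaklyRegular_flatMap_pathBinomials
    (freeOf_bot.sup (freeOf_ofList ?_)) hL⟩
  simp only [List.map_append, List.map_map, List.mem_append, List.mem_map]
  rintro f (⟨v, hv, rfl⟩ | ⟨v, hv, rfl⟩) <;>
    exact X_mem_supported.2 fun h => hsL hv h

theorem length_cutSequence (hL : [] ∉ L) :
    (cutSequence k s L).length + L.length = 2 * s.length + L.flatten.length := by
  have hpaths : (L.flatMap (pathBinomials k)).length + L.length = L.flatten.length := by
    induction L with
    | nil => rfl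
    | cons l L ih =>
      have hl : 0 < l.length := List.length_pos_of_ne_nil (by grind)
      have := ih (by grind)
      simp only [List.flatMap_cons, List.length_append, List.length_cons, List.flatten_cons,
        length_pathBinomials]
      omega
  simp only [cutSequence, List.length_append, List.length_map]
  omega

/-- The prime containing the sequence in the proof is the ideal of the point with `x_v = 1` for
`v ∉ s` and all other coordinates `0`. At primes inside it the variables `x_v` with `v ∉ s` do not
vanish, so that the sequence generates all binomials of the pairs in one list. -/
theorem not_isSMulRegular_quotient_ofList_cutSequence (hsL : s.Disjoint L.flatten)
    {p : MvPolynomial (V ⊕ V) k}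
    (hp : ∀ Q : Ideal (MvPolynomial (V ⊕ V) k), (∀ t ∈ vertexVars {v | v ∈ s}, X t ∈ Q) →
      (∀ l ∈ L, ∀ i ∈ l, ∀ j ∈ l, edgeBinomial k i j ∈ Q) → p ∈ Q) :
    ¬ IsSMulRegular (MvPolynomial (V ⊕ V) k ⧸ Ideal.ofList (cutSequence k s L)) p := by
  classical
  let φ : MvPolynomial (V ⊕ V) k →ₐ[k] k :=
    aeval (Sum.elim (fun v => if v ∈ s then 0 else 1) fun _ => 0)
  have hprime : (RingHom.ker φ).IsPrime := RingHom.ker_isPrime _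
  refine not_isSMulRegular_quotient_of_forall_isPrime (P := RingHom.ker φ) ?_ fun Q hQ hfs hQφ => ?_
  · refine ofList_le_iff.2 fun f hf => ?_
    rcases mem_cutSequence.1 hf with ⟨t | t, ht, rfl⟩ | ⟨l, -, hf⟩
    · simp_all [φ, vertexVars]
    · simp [φ]
    · obtain ⟨i, -, j, -, rfl⟩ := exists_of_mem_pathBinomials hf
      simp [φ, edgeBinomial]
  · rw [ofList_le_iff] at hfs
    refine hp Q (fun t ht => hfs _ (mem_cutSequence.2 (Or.inl ⟨t, ht, rfl⟩))) fun l hl i hi j hj =>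
      edgeBinomial_mem_of_pathBinomials (fun w hw hwQ => ?_)
        (fun f hf => hfs f (mem_cutSequence.2 (Or.inr ⟨l, hl, hf⟩))) hi hj
    have hws : w ∉ s := fun h => hsL h (List.mem_flatten_of_mem hl hw)
    simpa [φ, hws] using hQφ hwQ

theorem exists_list_fibers {α C : Type*} [Finite α] {κ : α → C} (hκ : Function.Surjective κ) :
    ∃ L : List (List α), L.flatten.Nodup ∧ (∀ a, a ∈ L.flatten) ∧ [] ∉ L ∧ L.length = Nat.card C ∧
      ∀ a b, κ a = κ b ↔ ∃ l ∈ L, a ∈ l ∧ b ∈ l := by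
  classical
  have := Fintype.ofFinite α
  have := Fintype.ofSurjective κ hκ
  let fiber : C → List α := fun c => (Finset.univ.filter (κ · = c)).toList
  have mem_fiber : ∀ c a, a ∈ fiber c ↔ κ a = c := by simp [fiber]
  refine ⟨(Finset.univ : Finset C).toList.map fiber, List.nodup_flatten.2 ⟨?_, ?_⟩, ?_, ?_, ?_, ?_⟩
  · simp [fiber, Finset.nodup_toList]
  · refine List.Pairwise.map _ (fun c d hcd a hc hd => hcd ?_) (Finset.nodup_toList _)
    rw [← (mem_fiber c a).1 hc, (mem_fiber d a).1 hd]
  · simp [mem_fiber]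
  · simp only [List.mem_map, not_exists, not_and]
    rintro c - hc
    obtain ⟨a, ha⟩ := hκ c
    simpa [hc] using (mem_fiber c a).2 ha
  · simp [Nat.card_eq_fintype_card]
  · simp [mem_fiber, eq_comm]

theorem exists_componentLists [Finite V] (G : SimpleGraph V) (S : Set V) :
    ∃ L : List (List V), L.flatten.Nodup ∧ (∀ v, v ∈ L.flatten ↔ v ∉ S) ∧ [] ∉ L ∧
      L.length = Nat.card (G.induce Sᶜ).ConnectedComponent ∧
      ∀ i j : ↥Sᶜ, (G.induce Sᶜ).Reachable i j ↔ ∃ l ∈ L, (i : V) ∈ l ∧ (j : V) ∈ l := by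
  obtain ⟨L, hnodup, hmem, hnil, hlen, hreach⟩ :=
    exists_list_fibers (κ := (G.induce Sᶜ).connectedComponentMk) Quot.mk_surjective
  have hflat : (L.map (List.map Subtype.val)).flatten = L.flatten.map Subtype.val :=
    List.map_flatten.symm
  refine ⟨L.map (List.map Subtype.val), ?_, fun v => ?_, ?_, by simpa, fun i j => ?_⟩
  · exact hflat ▸ hnodup.map Subtype.val_injective
  · simp only [hflat, List.mem_map, hmem, true_and, Subtype.exists, Set.mem_compl_iff,
      exists_prop, exists_eq_right]
  · simpa only [List.mem_map, List.map_eq_nil_iff, exists_eq_right] using hnil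
  · simpa [SimpleGraph.ConnectedComponent.eq] using hreach i j

/-- The height `|V| + |S| - c(G \ S)` of the ideal `P_S(G)`. The truncated subtraction is harmless,
since `G \ S` has at most `|V|` components. -/
noncomputable def cutHeight (G : SimpleGraph V) (S : Set V) : ℕ :=
  Nat.card V + S.ncard - Nat.card (G.induce Sᶜ).ConnectedComponent

theorem cutIdeal_ne_top : cutIdeal k G S ≠ ⊤ := by
  have hker : cutIdeal k G S ≤ RingHom.ker (constantCoeff (R := k)) := by
    refine cutIdeal_le_iff.2 ⟨fun t _ => ?_, fun i j _ => ?_⟩ <;> simp [edgeBinomial]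
  exact ne_top_of_le_ne_top (RingHom.ker_ne_top _) hker

theorem idealGrade_cutIdeal [Finite V] : idealGrade (cutIdeal k G S) = cutHeight G S := by
  classical
  obtain ⟨L, hnodup, hmem, hnil, hlen, hreach⟩ := exists_componentLists G S
  obtain ⟨s, hsnodup, hs⟩ : ∃ s : List V, s.Nodup ∧ ∀ v, v ∈ s ↔ v ∈ S :=
    ⟨S.toFinite.toFinset.toList, Finset.nodup_toList _, by simp⟩
  have hsS : {v | v ∈ s} = S := Set.ext hs
  have hsL : s.Disjoint L.flatten := fun v hv hvL => (hmem v).1 hvL ((hs v).1 hv)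
  have hlist {l : List V} (hl : l ∈ L) {i : V} (hi : i ∈ l) : i ∈ Sᶜ :=
    (hmem i).1 (List.mem_flatten_of_mem hl hi)
  rw [idealGrade_eq_length cutIdeal_ne_top
    (isWeaklyRegular_cutSequence hsnodup hnodup hsL)]
  · have hslen : s.length = S.ncard := by
      rw [← hsS, ← List.toFinset_card_of_nodup hsnodup, ← Set.ncard_coe_finset, List.coe_toFinset]
    have hLlen : L.flatten.length + S.ncard = Nat.card V := by
      rw [← Set.ncard_add_ncard_compl S, add_comm, ← List.toFinset_card_of_nodup hnodup,
        ← Set.ncard_coe_finset]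
      congr 2
      ext v
      simpa using hmem v
    have := length_cutSequence (k := k) (s := s) hnil
    rw [cutHeight, Nat.cast_inj]
    omega
  · intro f hf
    rcases mem_cutSequence.1 hf with ⟨t, ht, rfl⟩ | ⟨l, hl, hf⟩
    · exact X_mem_cutIdeal (hsS ▸ ht)
    · obtain ⟨i, hi, j, hj, rfl⟩ := exists_of_mem_pathBinomials hf
      exact edgeBinomial_mem_cutIdeal (i := ⟨i, hlist hl hi⟩) (j := ⟨j, hlist hl hj⟩)
        ((hreach _ _).2 ⟨l, hl, hi, hj⟩)
  · refine fun p hp => not_isSMulRegular_quotient_ofList_cutSequence hsL fun Q hX hedge => ?_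
    refine cutIdeal_le_iff.2 ⟨hsS ▸ hX, fun i j hij => ?_⟩ hp
    obtain ⟨l, hl, hi, hj⟩ := (hreach i j).1 hij
    exact hedge l hl i hi j hj

theorem idealGrade_binomialEdgeIdeal [Finite V] :
    idealGrade (binomialEdgeIdeal k G) = ((⨅ S, cutHeight G S : ℕ) : ℕ∞) := by
  apply le_antisymm
  · obtain ⟨S, hS⟩ := ciInf_mem (cutHeight G)
    rw [← hS, ← idealGrade_cutIdeal (k := k)]
    exact idealGrade_mono binomialEdgeIdeal_le_cutIdeal
  · have hG : binomialEdgeIdeal k G ≠ ⊤ :=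
      ne_top_of_le_ne_top cutIdeal_ne_top (binomialEdgeIdeal_le_cutIdeal (S := ∅))
    obtain ⟨Q, hQ, hGQ, hgrade⟩ := exists_isPrime_idealGrade_eq hG
    obtain ⟨S, hS⟩ := exists_cutIdeal_le_of_isPrime hGQ
    calc ((⨅ S, cutHeight G S : ℕ) : ℕ∞)
      _ ≤ cutHeight G S := Nat.cast_le.2 (ciInf_le (OrderBot.bddBelow _) S)
      _ = idealGrade (cutIdeal k G S) := idealGrade_cutIdeal.symm
      _ ≤ idealGrade Q := idealGrade_mono hS
      _ = idealGrade (binomialEdgeIdeal k G) := hgrade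

end CutIdeal

section Forests

open SimpleGraph Finset

variable {V : Type*} {F G : SimpleGraph V}

theorem isAcyclic_of_connectedComponents
    (h : ∀ c : F.ConnectedComponent, c.toSimpleGraph.IsAcyclic) : F.IsAcyclic := by
  classical
  intro v p hp
  have hsupp : ∀ w ∈ p.support, w ∈ (F.connectedComponentMk v).supp := fun w hw =>
    ConnectedComponent.sound (p.takeUntil w hw).reachable.symm
  have hcycle : (p.induce _ hsupp).IsCycle := by
    rwa [← Walk.isCycle_map_iff_of_injective (f := (Embedding.induce _).toHom)
      Subtype.val_injective, Walk.map_induce]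
  exact h (F.connectedComponentMk v) _ hcycle

theorem isAcyclic_pathGraph (n : ℕ) : (pathGraph n).IsAcyclic := by
  have isBridge_of_succ {u v : Fin n} (huv : u.val + 1 = v.val) :
      (pathGraph n).IsBridge s(u, v) := by
    refine isBridge_iff_forall_walk_mem_edges.2 fun p => ?_
    obtain ⟨⟨⟨a, b⟩, hab⟩, hd, (ha : a.val ≤ u.val), (hb : ¬ b.val ≤ u.val)⟩ :=
      p.exists_boundary_dart {w | w.val ≤ u.val} (le_refl u.val) (by simp; omega)
    have hsucc : a.val + 1 = b.val ∨ b.val + 1 = a.val := pathGraph_adj.1 hab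
    obtain ⟨rfl, rfl⟩ : a = u ∧ b = v := ⟨by omega, by omega⟩
    exact List.mem_map_of_mem hd
  refine isAcyclic_iff_forall_adj_isBridge.2 fun u v huv => ?_
  rcases pathGraph_adj.1 huv with h | h
  · exact isBridge_of_succ h
  · exact Sym2.eq_swap ▸ isBridge_of_succ h

theorem IsLinearForest.isAcyclic (hF : IsLinearForest F) : F.IsAcyclic :=
  isAcyclic_of_connectedComponents fun c =>
    let ⟨_, ⟨φ⟩⟩ := hF c
    φ.isAcyclic_iff.2 (isAcyclic_pathGraph _)

theorem degree_pathGraph_le_two {n : ℕ} (i : Fin n) [Fintype ((pathGraph n).neighborSet i)] :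
    (pathGraph n).degree i ≤ 2 := by
  rw [← card_neighborFinset_eq_degree, ← card_map Fin.valEmbedding]
  refine (card_le_card (t := {i.val - 1, i.val + 1}) fun j hj => ?_).trans card_le_two
  obtain ⟨j, hij, rfl⟩ := mem_map.1 hj
  rw [mem_neighborFinset, pathGraph_adj] at hij
  simp only [Fin.valEmbedding_apply, mem_insert, mem_singleton]
  omega

theorem degree_toSimpleGraph (c : F.ConnectedComponent) (v : c) [Fintype (F.neighborSet v)]
    [Fintype (c.toSimpleGraph.neighborSet v)] : c.toSimpleGraph.degree v = F.degree v := by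
  rw [← card_neighborFinset_eq_degree, ← card_neighborFinset_eq_degree,
    ← card_map (Function.Embedding.subtype _)]
  congr 1
  ext w
  simp only [mem_map, mem_neighborFinset, Function.Embedding.subtype_apply]
  refine ⟨?_, fun hvw => ⟨⟨w, (c.mem_supp_congr_adj hvw).1 v.2⟩, hvw, rfl⟩⟩
  rintro ⟨w, hvw, rfl⟩
  exact hvw

theorem IsLinearForest.degree_le_two (hF : IsLinearForest F) (v : V)
    [Fintype (F.neighborSet v)] : F.degree v ≤ 2 := by
  classical
  obtain ⟨m, ⟨φ⟩⟩ := hF (F.connectedComponentMk v)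
  have := Fintype.ofEquiv _ φ.toEquiv.symm
  calc F.degree v = (F.connectedComponentMk v).toSimpleGraph.degree ⟨v, rfl⟩ :=
        (degree_toSimpleGraph _ ⟨v, rfl⟩).symm
    _ = (pathGraph m).degree (φ ⟨v, rfl⟩) := (φ.degree_eq ⟨v, rfl⟩).symm
    _ ≤ 2 := degree_pathGraph_le_two _

theorem isLeaf_iff [Fintype V] [DecidableRel F.Adj] {v : V} : IsLeaf F v ↔ F.degree v ≤ 1 := by
  rw [IsLeaf, Set.encard_eq_coe_toFinset_card]
  exact_mod_cast Iff.rfl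

theorem card_edgeFinset_add_card_connectedComponent [Fintype V] [DecidableRel F.Adj]
    (hF : F.IsAcyclic) : #F.edgeFinset + Nat.card F.ConnectedComponent = Fintype.card V := by
  classical
  have hcomponent (c : F.ConnectedComponent) : ∑ v : c, F.degree v + 2 = ∑ _v : c, 2 := by
    have hedges := (hF.isTree_connectedComponent c).card_edgeFinset
    have hdegrees := sum_degrees_eq_twice_card_edges c.toSimpleGraph
    simp only [degree_toSimpleGraph] at hdegrees
    rw [sum_const, card_univ, smul_eq_mul]
    omega
  have hfiber (f : V → ℕ) : ∑ c : F.ConnectedComponent, ∑ v : c, f v = ∑ v, f v :=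
    (Fintype.sum_sigma' _).symm.trans
      ((Equiv.sigmaFiberEquiv F.connectedComponentMk).sum_comp f)
  have hsum : 2 * #F.edgeFinset + Fintype.card F.ConnectedComponent * 2 = Fintype.card V * 2 :=
    calc _ = ∑ c : F.ConnectedComponent, (∑ v : c, F.degree v + 2) := by
          rw [sum_add_distrib, hfiber fun v => F.degree v, sum_degrees_eq_twice_card_edges]; simp
      _ = ∑ c : F.ConnectedComponent, ∑ _v : c, 2 := sum_congr rfl fun c _ => hcomponent c
      _ = _ := by rw [hfiber fun _ => 2]; simp
  rw [Nat.card_eq_fintype_card]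
  omega

theorem card_edgeFinset_add_card_edgeFinset_induce [Fintype V] [DecidableRel F.Adj] (S : Set V)
    [DecidablePred (· ∈ S)] :
    #F.edgeFinset + #(F.induce S).edgeFinset =
      #(F.induce Sᶜ).edgeFinset + ∑ v ∈ S.toFinset, F.degree v := by
  classical
  have hinduce (T : Set V) [DecidablePred (· ∈ T)] :
      #(F.induce T).edgeFinset = ∑ e ∈ F.edgeFinset, if e ∈ T.toFinset.sym2 then 1 else 0 := by
    rw [← card_map, map_edgeFinset_induce, ← filter_mem_eq_inter, card_filter]
  have hdegree : ∑ v ∈ S.toFinset, F.degree v =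
      ∑ e ∈ F.edgeFinset, #{v ∈ S.toFinset | v ∈ e} := by
    simp only [← card_incidenceFinset_eq_degree, incidenceFinset_eq_filter]
    exact sum_card_bipartiteAbove_eq_sum_card_bipartiteBelow (· ∈ ·)
  rw [hinduce, hinduce, hdegree, card_eq_sum_ones, ← sum_add_distrib, ← sum_add_distrib]
  refine sum_congr rfl fun e he => ?_
  induction e using Sym2.ind with | _ u v
  have huv : u ≠ v := (mem_edgeFinset.1 he).ne
  have hends : {w ∈ S.toFinset | w ∈ s(u, v)} = {w ∈ ({u, v} : Finset V) | w ∈ S} := by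
    ext w
    simp [and_comm]
  rw [hends]
  by_cases hu : u ∈ S <;> by_cases hv : v ∈ S <;>
    simp [hu, hv, huv, filter_insert, filter_singleton]

theorem cutHeight_add_card_connectedComponent [Finite V] (G : SimpleGraph V) (S : Set V) :
    cutHeight G S + Nat.card (G.induce Sᶜ).ConnectedComponent = Nat.card V + S.ncard := by
  have hcomponents : Nat.card (G.induce Sᶜ).ConnectedComponent ≤ Nat.card ↥Sᶜ :=
    Nat.card_le_card_of_surjective _ Quot.mk_surjective
  have hcompl := S.ncard_add_ncard_compl
  rw [Nat.card_coe_set_eq] at hcomponents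
  rw [cutHeight]
  omega

theorem cutHeight_eq_of_isAcyclic [Fintype V] [DecidableRel F.Adj] (hF : F.IsAcyclic)
    (S : Set V) [DecidablePred (· ∈ S)] :
    cutHeight F S = #(F.induce Sᶜ).edgeFinset + 2 * #S.toFinset := by
  have hforest := card_edgeFinset_add_card_connectedComponent (hF.induce Sᶜ)
  have hcompl := S.ncard_add_ncard_compl
  have hcut := cutHeight_add_card_connectedComponent F S
  rw [← Nat.card_eq_fintype_card, Nat.card_coe_set_eq] at hforest
  rw [← Set.ncard_eq_toFinset_card']
  omega

theorem IsLinearForest.ncard_edgeSet_le_cutHeight_self [Finite V] (hF : IsLinearForest F)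
    (S : Set V) : F.edgeSet.ncard ≤ cutHeight F S := by
  classical
  have := Fintype.ofFinite V
  have hcount := card_edgeFinset_add_card_edgeFinset_induce (F := F) S
  have hdegree : ∑ v ∈ S.toFinset, F.degree v ≤ #S.toFinset * 2 :=
    sum_le_card_nsmul _ _ _ fun v _ => hF.degree_le_two v
  rw [cutHeight_eq_of_isAcyclic hF.isAcyclic, Set.ncard_eq_toFinset_card', Set.toFinset_card,
    ← edgeFinset_card]
  omega

theorem IsLinearForest.ncard_edgeSet_eq_cutHeight_self_iff [Finite V] (hF : IsLinearForest F)
    (S : Set V) :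
    F.edgeSet.ncard = cutHeight F S ↔
      (∀ v ∈ S, ¬ IsLeaf F v) ∧ ∀ v ∈ S, ∀ w ∈ S, ¬ F.Adj v w := by
  classical
  have := Fintype.ofFinite V
  have hcount := card_edgeFinset_add_card_edgeFinset_induce (F := F) S
  have htwo : ∑ _v ∈ S.toFinset, 2 = 2 * #S.toFinset := by rw [sum_const, smul_eq_mul, mul_comm]
  have hdegree : ∑ v ∈ S.toFinset, F.degree v ≤ ∑ _v ∈ S.toFinset, 2 :=
    sum_le_sum fun v _ => hF.degree_le_two v
  have hleaf : ∑ v ∈ S.toFinset, F.degree v = ∑ _v ∈ S.toFinset, 2 ↔ ∀ v ∈ S, ¬ IsLeaf F v := by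
    rw [sum_eq_sum_iff_of_le fun v _ => hF.degree_le_two v]
    simp only [Set.mem_toFinset, isLeaf_iff, not_le]
    exact forall₂_congr fun v _ => ⟨fun h => by omega, fun h => (hF.degree_le_two v).antisymm h⟩
  have hindep : #(F.induce S).edgeFinset = 0 ↔ ∀ v ∈ S, ∀ w ∈ S, ¬ F.Adj v w := by
    rw [card_eq_zero, edgeFinset_eq_empty, eq_bot_iff_forall_not_adj]
    simp
  rw [cutHeight_eq_of_isAcyclic hF.isAcyclic, Set.ncard_eq_toFinset_card', Set.toFinset_card,
    ← edgeFinset_card, ← hleaf, ← hindep]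
  omega

theorem card_connectedComponent_eq_iff [Finite V] (h : F ≤ G) :
    Nat.card F.ConnectedComponent = Nat.card G.ConnectedComponent ↔
      ∀ i j, G.Adj i j → F.Reachable i j := by
  have hsurj := ConnectedComponent.surjective_map_ofLE h
  have hinj : Function.Injective (ConnectedComponent.map (Hom.ofLE h)) ↔
      ∀ i j, G.Adj i j → F.Reachable i j := by
    refine ⟨fun hinj i j hij =>
      ConnectedComponent.exact (hinj (ConnectedComponent.sound hij.reachable)), fun hadj c d => ?_⟩
    induction c, d using ConnectedComponent.ind₂ with | _ a b
    refine fun hab => ConnectedComponent.sound ?_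
    have hchain := (reachable_iff_reflTransGen a b).1 (ConnectedComponent.exact hab)
    exact (reachable_iff_reflTransGen a b).2 <|
      hchain.lift' id fun i j hij => (reachable_iff_reflTransGen i j).1 (hadj i j hij)
  rw [← hinj]
  exact ⟨fun hcard => (hsurj.bijective_of_nat_card_le hcard.le).1,
    fun hinj => Nat.card_congr (Equiv.ofBijective _ ⟨hinj, hsurj⟩)⟩

theorem cutHeight_mono [Finite V] (h : F ≤ G) (S : Set V) : cutHeight F S ≤ cutHeight G S :=
  Nat.sub_le_sub_left (ConnectedComponent.card_le_card_of_le (comap_monotone _ h)) _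

theorem cutHeight_eq_iff [Finite V] (h : F ≤ G) (S : Set V) :
    cutHeight F S = cutHeight G S ↔
      ∀ i j, (G.induce Sᶜ).Adj i j → (F.induce Sᶜ).Reachable i j := by
  have hFcut := cutHeight_add_card_connectedComponent F S
  have hGcut := cutHeight_add_card_connectedComponent G S
  have hle : F.induce Sᶜ ≤ G.induce Sᶜ := comap_monotone _ h
  rw [← card_connectedComponent_eq_iff hle]
  omega

theorem IsLinearForest.ncard_edgeSet_le_cutHeight [Finite V] (hF : IsLinearForest F) (h : F ≤ G)
    (S : Set V) : F.edgeSet.ncard ≤ cutHeight G S :=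
  (hF.ncard_edgeSet_le_cutHeight_self S).trans (cutHeight_mono h S)

theorem IsMaximalLinearForest.isLFCover_iff [Finite V] (hF : IsMaximalLinearForest G F)
    (S : Set V) : IsLFCover G F S ↔ F.edgeSet.ncard = cutHeight G S := by
  have heq : F.edgeSet.ncard = cutHeight G S ↔
      F.edgeSet.ncard = cutHeight F S ∧ cutHeight F S = cutHeight G S := by
    have := hF.isLinearForest.ncard_edgeSet_le_cutHeight_self S
    have := cutHeight_mono hF.le S
    omega
  rw [heq, hF.isLinearForest.ncard_edgeSet_eq_cutHeight_self_iff, cutHeight_eq_iff hF.le]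
  refine ⟨fun h => ⟨⟨h.not_leaf, h.not_adj⟩, fun i j hij => ?_⟩,
    fun ⟨⟨hleaf, hindep⟩, hreach⟩ => ⟨hF, hleaf, hindep, fun i j hij => ?_⟩⟩
  · rcases h.covers i j hij with (hi | hj) | ⟨_, _, h⟩
    exacts [absurd hi i.2, absurd hj j.2, h]
  · by_cases hS : i ∈ S ∨ j ∈ S
    · exact Or.inl hS
    · obtain ⟨hi, hj⟩ := not_or.1 hS
      exact Or.inr ⟨hi, hj, hreach ⟨i, hi⟩ ⟨j, hj⟩ hij⟩

theorem isLinearForest_bot : IsLinearForest (⊥ : SimpleGraph V) := by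
  intro c
  have hsubsingleton : Subsingleton c := ⟨fun a b =>
    Subtype.ext (reachable_bot.1 (ConnectedComponent.exact (a.2.trans b.2.symm)))⟩
  have hnonempty : Nonempty c := c.nonempty_supp.to_subtype
  obtain ⟨_⟩ := nonempty_unique c
  exact ⟨1, ⟨⟨Equiv.ofUnique _ _, fun {a b} => by simp [Subsingleton.elim a b]⟩⟩⟩

theorem exists_isMaximalLinearForest [Finite V] (G : SimpleGraph V) :
    ∃ F, IsMaximalLinearForest G F := by
  obtain ⟨F, ⟨hle, hF⟩, hmax⟩ := Set.exists_max_image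
    {F : SimpleGraph V | F ≤ G ∧ IsLinearForest F} (fun F => F.edgeSet.encard) (Set.toFinite _)
    ⟨⊥, bot_le, isLinearForest_bot⟩
  exact ⟨F, hle, hF, fun F' hle' hF' => hmax F' ⟨hle', hF'⟩⟩

theorem IsMaximalLinearForest.LF_eq [Finite V] (hF : IsMaximalLinearForest G F) :
    LF G = F.edgeSet.ncard := by
  rw [(Set.toFinite F.edgeSet).cast_ncard_eq]
  exact le_antisymm (iSup₂_le fun F' hle => iSup_le fun hF' => hF.maximal F' hle hF')
    (le_iSup₂_of_le F hF.le (le_iSup_of_le hF.isLinearForest le_rfl))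

end Forests

theorem isKonigType_iff {k : Type*} [Field k] {V : Type*} [Finite V] {G F : SimpleGraph V}
    (hF : IsMaximalLinearForest G F) :
    IsKonigType k G ↔ F.edgeSet.ncard = ⨅ S, cutHeight G S := by
  rw [IsKonigType, idealGrade_binomialEdgeIdeal, hF.LF_eq, Nat.cast_inj, eq_comm]

theorem mainTheorem1 (k : Type*) [Field k] {V : Type*} [Finite V] (G : SimpleGraph V) :
    (IsKonigType k G ↔ IsLFCoverable G) ∧
    (∀ F F' : SimpleGraph V, IsMaximalLinearForest G F → IsMaximalLinearForest G F' →
      ∀ S : Set V, IsLFCover G F S ↔ IsLFCover G F' S) := by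
  refine ⟨⟨fun hK => ?_, fun ⟨F, S, hFS⟩ => ?_⟩, fun F F' hF hF' S => ?_⟩
  · obtain ⟨F, hF⟩ := exists_isMaximalLinearForest G
    obtain ⟨S, hS⟩ := ciInf_mem (cutHeight G)
    exact ⟨F, S, (hF.isLFCover_iff S).2 (((isKonigType_iff hF).1 hK).trans hS.symm)⟩
  · have hF := hFS.isMaximal
    refine (isKonigType_iff hF).2 (le_antisymm ?_ ?_)
    · exact le_ciInf fun T => hF.isLinearForest.ncard_edgeSet_le_cutHeight hF.le T
    · exact ((hF.isLFCover_iff S).1 hFS).symm ▸ ciInf_le (OrderBot.bddBelow _) S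
  · have hcard : F.edgeSet.ncard = F'.edgeSet.ncard := by
      rw [← Nat.cast_inj (R := ℕ∞), ← hF.LF_eq, hF'.LF_eq]
    rw [hF.isLFCover_iff, hF'.isLFCover_iff, hcard]
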